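/- Let $A$ be a unital $C^*$-algebra with a faithful tracial state $\phi$, put $\|x\|_2=\phi(x^*x)^{1/2}$, and let $a_1,\dots,a_n\in A$ be freely independent, in the sense that the unital $*$-subalgebras $A_i$ generated by the $a_i$ satisfy $\phi(x_1x_2\cdots x_m)=0$ whenever $m\ge 1$, $x_j\in A_{i_j}$, $\phi(x_j)=0$ for all $j$, and $i_j\neq i_{j+1}$ for $1\le j<m$. For $s\in\mathbb{C}$ such that $1-sa_i$ is invertible let $$f_i(s)=\phi\big((1-sa_i)^{-1}\big),\qquad \overset{\circ}{a}_i(s)=(1-sa_i)^{-1}-f_i(s)$$ be the moment generating function of $a_i$ and the centered part of the resolvent. For $\lambda\in\mathbb{C}$, say that $(z,s_1,\dots,s_n)\in\mathbb{C}^{n+1}$ is a parameter of $\lambda$ if $z\neq0$, every $1-s_ia_i$ is invertible, $s_if_i(s_i)=z$ for every $i$ (so that $s_i\ne 0$ and $f_i(s_i)\neq 0$), and $$\lambda=\frac1z+\sum_{i=1}^n\Big(\frac1{s_i}-\frac1z\Big).$$ For a parameter put $$C(s_1,\dots,s_n)=\sum_{i=1}^n\frac{x_i}{1+x_i},\qquad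 x_i=\Big\|\frac{\overset{\circ}{a}_i(s_i)}{f_i(s_i)}\Big\|_2^2 .$$ Let $(z,s_1,\dots,s_n)$ be a parameter of $\lambda\in\mathbb{C}$. 1. If $C(s_1,\dots,s_n)<1$, then $\lambda\notin\sigma\big(\sum_i a_i\big)$. 2. If $C(s_1,\dots,s_n)=1$ and there are $\lambda'$ arbitrarily close to $\lambda$ that have a parameter $(z',s_1',\dots,s_n')$ with $C(s_1',\dots,s_n')<1$, then $\lambda\in\sigma\big(\sum_i a_i\big)$. -/

import Mathlib

open scoped ComplexOrder

noncomputable section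

namespace FreeSpectra

/-- A positive functional `φ` on a unital C⋆-algebra is a faithful tracial state: it is unital,
faithful and has the trace property. (Positivity is part of the type `A →ₚ[ℂ] ℂ`.) -/
structure IsFaithfulTracialState {A : Type*} [CStarAlgebra A] [PartialOrder A]
    (φ : A →ₚ[ℂ] ℂ) : Prop where
  map_one : φ 1 = 1
  faithful : ∀ x : A, φ (star x * x) = 0 → x = 0
  tracial : ∀ x y : A, φ (x * y) = φ (y * x)

/-- Free independence of a family `B` of subalgebras: `φ (x₁ x₂ ⋯ xₘ) = 0` for every nonempty
word with `xⱼ ∈ B (iⱼ)`, `φ xⱼ = 0`, and neighbouring indices different. A word is the list of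
the pairs `(iⱼ, xⱼ)`. -/
def FreelyIndependent {A : Type*} [CStarAlgebra A] [PartialOrder A] {ι : Type*}
    (φ : A →ₚ[ℂ] ℂ) (B : ι → Subalgebra ℂ A) : Prop :=
  ∀ w : List (ι × A), w ≠ [] → (∀ p ∈ w, p.2 ∈ B p.1 ∧ φ p.2 = 0) →
    w.IsChain (fun p q => p.1 ≠ q.1) → φ (w.map Prod.snd).prod = 0

/-- A family of elements is (⋆-)free if the unital ⋆-subalgebras they generate are free. -/
def StarFree {A : Type*} [CStarAlgebra A] [PartialOrder A] {ι : Type*}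
    (φ : A →ₚ[ℂ] ℂ) (a : ι → A) : Prop :=
  FreelyIndependent φ fun i => (StarAlgebra.adjoin ℂ {a i}).toSubalgebra

/-- The norm `‖x‖₂ = φ (x⋆ x) ^ (1/2)`. -/
def l2Norm {A : Type*} [CStarAlgebra A] [PartialOrder A] (φ : A →ₚ[ℂ] ℂ) (x : A) : ℝ :=
  √(φ (star x * x)).re

/-- The moment generating function `f(s) = φ ((1 - s a)⁻¹)`, meaningful when `1 - s a` is
invertible. -/
def mgf {A : Type*} [CStarAlgebra A] [PartialOrder A] (φ : A →ₚ[ℂ] ℂ) (a : A) (s : ℂ) : ℂ :=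
  φ (Ring.inverse (1 - s • a))

/-- The centered resolvent `(1 - s a)⁻¹ - f(s)`, meaningful when `1 - s a` is invertible. -/
def centeredResolvent {A : Type*} [CStarAlgebra A] [PartialOrder A]
    (φ : A →ₚ[ℂ] ℂ) (a : A) (s : ℂ) : A :=
  Ring.inverse (1 - s • a) - algebraMap ℂ A (mgf φ a s)

/-- The numbers `z ≠ 0` and `sᵢ` parametrize `lam`: each `1 - sᵢ aᵢ` is invertible,
`sᵢ fᵢ(sᵢ) = z` and `lam = 1/z + ∑ᵢ (1/sᵢ - 1/z)`. (Each `sᵢ` is nonzero because `z` is.) -/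
structure IsParam {A : Type*} [CStarAlgebra A] [PartialOrder A] {n : ℕ}
    (φ : A →ₚ[ℂ] ℂ) (a : Fin n → A) (lam z : ℂ) (s : Fin n → ℂ) : Prop where
  z_ne_zero : z ≠ 0
  isUnit : ∀ i, IsUnit (1 - s i • a i)
  mul_mgf : ∀ i, s i * mgf φ (a i) (s i) = z
  lam_eq : lam = 1 / z + ∑ i, (1 / s i - 1 / z)

/-- The sum over `i` of `xᵢ / (1 + xᵢ)`, where `xᵢ = ‖fᵢ(sᵢ)⁻¹ åᵢ(sᵢ)‖₂²` and `åᵢ(sᵢ)` is the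
centered resolvent of `aᵢ` at `sᵢ`. -/
def criterion {A : Type*} [CStarAlgebra A] [PartialOrder A] {n : ℕ}
    (φ : A →ₚ[ℂ] ℂ) (a : Fin n → A) (s : Fin n → ℂ) : ℝ :=
  ∑ i, l2Norm φ ((mgf φ (a i) (s i))⁻¹ • centeredResolvent φ (a i) (s i)) ^ 2 /
    (1 + l2Norm φ ((mgf φ (a i) (s i))⁻¹ • centeredResolvent φ (a i) (s i)) ^ 2)

end FreeSpectra

end

open scoped ComplexOrder

/-! Put `rᵢ = fᵢ(sᵢ) (1 - sᵢ aᵢ)`. Its inverse is `1 + xᵢ`, where `xᵢ = åᵢ(sᵢ) / fᵢ(sᵢ)` is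
centered, and the parametrization says exactly that `λ - ∑ aᵢ = z⁻¹ (1 - ∑ (1 - rᵢ))`
(`sub_sum_eq_smul`).

Represent the algebra generated by the `aᵢ` on its GNS space and let `pᵢ` project onto the closed
span of the reduced words starting with index `i`. By freeness the `pᵢ` are mutually orthogonal, and
a centered `xᵢ` has no `(1 - pᵢ)`-corner: it sends a word not starting with `i` to one that does.
Block elimination then gives `1 - ∑ (1 - rᵢ) = (1 - L') D (1 - L)` (`one_sub_sum_eq_factorization`)
with `D` always invertible, `L = ∑ pᵢ xᵢ (1 - pᵢ)` and `L' = ∑ (1 - pᵢ) xᵢ pᵢ`. By traciality the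
adjoint of `L'` is an operator like `L` with the same constants `tᵢ = ‖xᵢ‖₂²`.

The form `q(ξ) = ‖ξ‖² - ∑ tᵢ/(1+tᵢ) ‖pᵢ ξ‖²` is equivalent to `‖ξ‖²` and satisfies `q(Lξ) = q(ξ) -
(1 - C) ‖ξ‖²` (`weightForm_creation`). For `C < 1` powers of `L` become small, so `1 - L` is
invertible. For `C = 1`, `L` is a `q`-isometry, and the partial sums of `∑ Lʲ Ω` show that `1 - L`
is not bounded below. -/

namespace FreeSpectra

/-! ### Block factorization in a ring with orthogonal idempotents -/

section Ring

variable {R : Type*} [Ring R]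

/-- A `2 × 2` block inversion: if the corner `(1 - p) x (1 - p)` vanishes, then the inverse `r` of
`1 + x` is determined by its corner `p r p`. -/
theorem inverse_eq_of_corner_eq_zero {p x r : R} (hp : p * p = p)
    (hx : (1 - p) * x * (1 - p) = 0) (hr : r * (1 + x) = 1) (hr' : (1 + x) * r = 1) :
    r = (1 - p) + (p - (1 - p) * x * p) * (p * r * p) * (p - p * x * (1 - p)) := by
  have e1 : (1 - p) * r = (1 - p) - (1 - p) * x * p * r := by
    have h : (1 - p) * ((1 + x) * r) = (1 - p) * r + (1 - p) * x * p * r +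
        ((1 - p) * x * (1 - p)) * r := by noncomm_ring
    rw [hr', hx] at h
    simp only [mul_one, zero_mul, add_zero] at h
    exact eq_sub_of_add_eq h.symm
  have e2 : r * (1 - p) = (1 - p) - r * p * x * (1 - p) := by
    have h : (r * (1 + x)) * (1 - p) = r * (1 - p) + r * p * x * (1 - p) +
        r * ((1 - p) * x * (1 - p)) := by noncomm_ring
    rw [hr, hx] at h
    simp only [one_mul, mul_zero, add_zero] at h
    exact eq_sub_of_add_eq h.symm
  have e3 : p * r = p * r * p * (p - p * x * (1 - p)) := by
    have h0 : p * (1 - p) = 0 := by rw [mul_sub, mul_one, hp, sub_self]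
    calc p * r = p * r * p + p * (r * (1 - p)) := by noncomm_ring
      _ = p * r * p + p * (1 - p) - p * r * p * x * (1 - p) := by rw [e2]; noncomm_ring
      _ = p * r * p - p * r * (p * p) * x * (1 - p) := by rw [h0, hp, add_zero]
      _ = p * r * (p * p) - p * r * (p * p) * x * (1 - p) := by rw [hp]
      _ = p * r * p * (p - p * x * (1 - p)) := by noncomm_ring
  have e4 : r = p * r + (1 - p) * r := by noncomm_ring
  have e5 : (p - (1 - p) * x * p) * (p * r) = p * r - (1 - p) * x * p * r := by
    simp only [sub_mul, ← mul_assoc, hp]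
    simp only [mul_assoc _ p p, hp]
  calc r = p * r + (1 - p) * r := e4
    _ = (1 - p) + (p * r - (1 - p) * x * p * r) := by rw [e1]; abel
    _ = (1 - p) + (p - (1 - p) * x * p) * (p * r) := by rw [e5]
    _ = (1 - p) + (p - (1 - p) * x * p) * (p * r * p * (p - p * x * (1 - p))) := by rw [← e3]
    _ = _ := by rw [mul_assoc _ (p * r * p)]

variable {ι : Type*} [Fintype ι]

/-- The sum of the lower left corners of the `x i` with respect to the idempotents `p i`. -/
def creation (p x : ι → R) : R := ∑ i, p i * x i * (1 - p i)

/-- The sum of the upper right corners of the `x i` with respect to the idempotents `p i`. -/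
def annihilation (p x : ι → R) : R := ∑ i, (1 - p i) * x i * p i

/-- The block diagonal element with blocks `p i * r i * p i`, and `1` on the complement. -/
def blockDiagonal (p r : ι → R) : R := 1 - ∑ i, p i + ∑ i, p i * r i * p i

variable [DecidableEq ι] {p x r : ι → R}

theorem one_sub_annihilation_mul (hp : ∀ i j, p i * p j = if i = j then p i else 0) (i : ι) :
    (1 - annihilation p x) * p i = p i - (1 - p i) * x i * p i := by
  rw [annihilation, sub_mul, one_mul, Finset.sum_mul]
  simp [mul_assoc, hp]

theorem mul_one_sub_creation (hp : ∀ i j, p i * p j = if i = j then p i else 0) (i : ι) :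
    p i * (1 - creation p x) = p i - p i * x i * (1 - p i) := by
  rw [creation, mul_sub, mul_one, Finset.mul_sum]
  simp [← mul_assoc, hp]

theorem sum_mul_idempotent (hp : ∀ i j, p i * p j = if i = j then p i else 0) (i : ι) :
    (∑ j, p j) * p i = p i := by
  simp [Finset.sum_mul, hp]

theorem idempotent_mul_sum (hp : ∀ i j, p i * p j = if i = j then p i else 0) (i : ι) :
    p i * (∑ j, p j) = p i := by
  simp [Finset.mul_sum, hp]

/-- Orthogonality of the idempotents lets the outer factors act on the `i`-th block through their
`i`-th summands only; block inversion turns that block into `r i - 1 + p i`. The complementary block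
`1 - ∑ i, p i` passes through unchanged. -/
theorem one_sub_sum_eq_factorization (hp : ∀ i j, p i * p j = if i = j then p i else 0)
    (hx : ∀ i, (1 - p i) * x i * (1 - p i) = 0)
    (hr : ∀ i, r i * (1 + x i) = 1) (hr' : ∀ i, (1 + x i) * r i = 1) :
    1 - ∑ i, (1 - r i) = (1 - annihilation p x) * blockDiagonal p r * (1 - creation p x) := by
  have hpp : ∀ i, p i * p i = p i := fun i => by simp [hp]
  have h1 : annihilation p x * (1 - ∑ i, p i) = 0 := by
    rw [annihilation, Finset.sum_mul]
    refine Finset.sum_eq_zero fun i _ => ?_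
    rw [mul_assoc, mul_sub, mul_one, idempotent_mul_sum hp, sub_self, mul_zero]
  have h2 : (1 - ∑ i, p i) * creation p x = 0 := by
    rw [creation, Finset.mul_sum]
    refine Finset.sum_eq_zero fun i _ => ?_
    rw [← mul_assoc, ← mul_assoc, sub_mul, one_mul, sum_mul_idempotent hp, sub_self, zero_mul,
      zero_mul]
  have h3 : (1 - annihilation p x) * (1 - ∑ i, p i) * (1 - creation p x) = 1 - ∑ i, p i := by
    rw [sub_mul, one_mul, h1, sub_zero, mul_sub, h2, sub_zero, mul_one]
  rw [blockDiagonal, mul_add, add_mul, h3, Finset.mul_sum, Finset.sum_mul]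
  have h4 : ∀ i, (1 - annihilation p x) * (p i * r i * p i) * (1 - creation p x)
      = r i - 1 + p i := by
    intro i
    have e := inverse_eq_of_corner_eq_zero (hpp i) (hx i) (hr i) (hr' i)
    have : (1 - annihilation p x) * (p i * r i * p i) * (1 - creation p x)
        = ((1 - annihilation p x) * p i) * (p i * r i * p i) * (p i * (1 - creation p x)) := by
      simp only [mul_assoc]
      simp only [← mul_assoc (p i) (p i), hpp]
    rw [this, one_sub_annihilation_mul hp, mul_one_sub_creation hp]
    conv_rhs => rw [e]
    abel
  simp only [h4, Finset.sum_add_distrib, Finset.sum_sub_distrib]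
  abel

/-- The middle factor is never an obstruction: `1 + x i` has the identity as its `(1 - p i)`-corner,
so its Schur complement exists and inverts the corner of `r i`. -/
theorem isUnit_blockDiagonal (hp : ∀ i j, p i * p j = if i = j then p i else 0)
    (hx : ∀ i, (1 - p i) * x i * (1 - p i) = 0)
    (hr : ∀ i, r i * (1 + x i) = 1) (hr' : ∀ i, (1 + x i) * r i = 1) :
    IsUnit (blockDiagonal p r) := by
  have hpp : ∀ i, p i * p i = p i := fun i => by simp [hp]
  have key : ∀ u v : ι → R, (∀ i, p i * u i * p i * (p i * v i * p i) = p i) →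
      blockDiagonal p u * blockDiagonal p v = 1 := by
    intro u v huv
    have h1 : (1 - ∑ i, p i) * ∑ i, p i * v i * p i = 0 := by
      rw [Finset.mul_sum]
      refine Finset.sum_eq_zero fun i _ => ?_
      rw [← mul_assoc, ← mul_assoc, sub_mul, one_mul, sum_mul_idempotent hp, sub_self, zero_mul,
        zero_mul]
    have h2 : (∑ i, p i * u i * p i) * (1 - ∑ i, p i) = 0 := by
      rw [Finset.sum_mul]
      refine Finset.sum_eq_zero fun i _ => ?_
      rw [mul_assoc, mul_sub, mul_one, idempotent_mul_sum hp, sub_self, mul_zero]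
    have h3 : (1 - ∑ i, p i) * (1 - ∑ i, p i) = 1 - ∑ i, p i := by
      have : (∑ i, p i) * (∑ i, p i) = ∑ i, p i := by
        rw [Finset.mul_sum]
        exact Finset.sum_congr rfl fun i _ => sum_mul_idempotent hp i
      rw [sub_mul, one_mul, mul_sub, mul_one, this]; abel
    have h4 : (∑ i, p i * u i * p i) * (∑ i, p i * v i * p i) = ∑ i, p i := by
      rw [Finset.sum_mul_sum]
      refine Finset.sum_congr rfl fun i _ => ?_
      rw [Finset.sum_eq_single i, huv]
      · intro j _ hj
        have : p i * u i * p i * (p j * v j * p j) = p i * u i * (p i * p j) * v j * p j := by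
          simp only [mul_assoc]
        rw [this, hp, if_neg (Ne.symm hj)]; simp
      · simp
    rw [blockDiagonal, blockDiagonal, add_mul, mul_add, mul_add, h1, h2, h3, h4]
    abel
  -- the inverse block is the Schur complement of the vanishing corner
  let q : ι → R := fun i => 1 + x i - x i * (1 - p i) * x i
  have e1 : ∀ i, (1 - p i) * x i * p i * r i = (1 - p i) - (1 - p i) * r i := by
    intro i
    have h : (1 - p i) * ((1 + x i) * r i) = (1 - p i) * r i + (1 - p i) * x i * p i * r i +
        ((1 - p i) * x i * (1 - p i)) * r i := by noncomm_ring
    rw [hr', hx] at h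
    simp only [mul_one, zero_mul, add_zero] at h
    rw [eq_sub_iff_add_eq, add_comm, ← h]
  have e2 : ∀ i, r i * p i * x i * (1 - p i) = (1 - p i) - r i * (1 - p i) := by
    intro i
    have h : (r i * (1 + x i)) * (1 - p i) = r i * (1 - p i) + r i * p i * x i * (1 - p i) +
        r i * ((1 - p i) * x i * (1 - p i)) := by noncomm_ring
    rw [hr, hx] at h
    simp only [one_mul, mul_zero, add_zero] at h
    rw [eq_sub_iff_add_eq, add_comm, ← h]
  have h0 : ∀ i, (1 - p i) * p i = 0 := fun i => by rw [sub_mul, one_mul, hpp, sub_self]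
  have h0' : ∀ i, p i * (1 - p i) = 0 := fun i => by rw [mul_sub, mul_one, hpp, sub_self]
  have k1 : blockDiagonal p q * blockDiagonal p r = 1 := by
    refine key q r fun i => ?_
    calc p i * q i * p i * (p i * r i * p i)
        = p i * q i * (p i * p i) * r i * p i := by simp only [mul_assoc]
      _ = p i * (1 + x i) * p i * r i * p i
          - p i * x i * ((1 - p i) * x i * p i * r i) * p i := by
          rw [hpp]; simp only [q]; noncomm_ring
      _ = p i * (1 + x i) * p i * r i * p i - p i * x i * ((1 - p i) * p i)
          + p i * (1 + x i) * (1 - p i) * r i * p i - (p i * (1 - p i)) * r i * p i := by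
          rw [e1]; noncomm_ring
      _ = p i * ((1 + x i) * r i) * p i := by rw [h0, h0']; noncomm_ring
      _ = p i := by rw [hr', mul_one, hpp]
  have k2 : blockDiagonal p r * blockDiagonal p q = 1 := by
    refine key r q fun i => ?_
    calc p i * r i * p i * (p i * q i * p i)
        = p i * r i * (p i * p i) * q i * p i := by simp only [mul_assoc]
      _ = p i * r i * p i * (1 + x i) * p i
          - p i * (r i * p i * x i * (1 - p i)) * x i * p i := by
          rw [hpp]; simp only [q]; noncomm_ring
      _ = p i * r i * p i * (1 + x i) * p i - (p i * (1 - p i)) * x i * p i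
          + p i * r i * (1 - p i) * (1 + x i) * p i - p i * r i * ((1 - p i) * p i) := by
          rw [e2]; noncomm_ring
      _ = p i * (r i * (1 + x i)) * p i := by rw [h0, h0']; noncomm_ring
      _ = p i := by rw [hr, mul_one, hpp]
  exact ⟨⟨_, _, k2, k1⟩, rfl⟩

end Ring

/-! ### The creation part on a Hilbert space -/

section Hilbert

open scoped InnerProductSpace
open ContinuousLinearMap

variable {H : Type*} [NormedAddCommGroup H] [InnerProductSpace ℂ H] [CompleteSpace H]
  {ι : Type*} [DecidableEq ι]

/-- Mutually orthogonal projections `p i` and operators `x i` with `(1 - p i) x i (1 - p i) = 0`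
which are `√(t i)` times an isometry on the range of `1 - p i`. -/
structure IsCreationFamily (p x : ι → (H →L[ℂ] H)) (t : ι → ℝ) : Prop where
  isSelfAdjoint : ∀ i, IsSelfAdjoint (p i)
  mul_eq : ∀ i j, p i * p j = if i = j then p i else 0
  corner : ∀ i, (1 - p i) * x i * (1 - p i) = 0
  nonneg : ∀ i, 0 ≤ t i
  norm_sq : ∀ i ξ, ‖x i ((1 - p i) ξ)‖ ^ 2 = t i * ‖(1 - p i) ξ‖ ^ 2

/-- The quadratic form `‖ξ‖² - ∑ tᵢ / (1 + tᵢ) ‖pᵢ ξ‖²`. -/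
noncomputable def weightForm [Fintype ι] (p : ι → (H →L[ℂ] H)) (t : ι → ℝ) (ξ : H) : ℝ :=
  ‖ξ‖ ^ 2 - ∑ i, t i / (1 + t i) * ‖p i ξ‖ ^ 2

namespace IsCreationFamily

variable {p x : ι → (H →L[ℂ] H)} {t : ι → ℝ} (h : IsCreationFamily p x t)
include h

theorem inner_apply (i : ι) (ξ η : H) : ⟪p i ξ, η⟫_ℂ = ⟪ξ, p i η⟫_ℂ := by
  have := (h.isSelfAdjoint i)
  rw [ContinuousLinearMap.isSelfAdjoint_iff'] at this
  conv_lhs => rw [← this]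
  rw [adjoint_inner_left]

theorem apply_apply (i j : ι) (ξ : H) : p i (p j ξ) = if i = j then p i ξ else 0 := by
  have := congrArg (fun T : H →L[ℂ] H => T ξ) (h.mul_eq i j)
  simp only [mul_apply_eq_comp] at this
  rw [this]; split_ifs <;> simp

theorem norm_sq_one_sub (i : ι) (ξ : H) : ‖(1 - p i) ξ‖ ^ 2 = ‖ξ‖ ^ 2 - ‖p i ξ‖ ^ 2 := by
  have e : ξ = (1 - p i) ξ + p i ξ := by simp
  have o : ⟪(1 - p i) ξ, p i ξ⟫_ℂ = 0 := by
    rw [← h.inner_apply]; simp [h.apply_apply]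
  have := norm_add_sq_eq_norm_sq_add_norm_sq_of_inner_eq_zero _ _ o
  rw [← e] at this
  nlinarith

variable [Fintype ι]

theorem apply_creation (i : ι) (ξ : H) : p i (creation p x ξ) = x i ((1 - p i) ξ) := by
  have e := congrArg (fun T : H →L[ℂ] H => T ξ) (mul_one_sub_creation (x := x) h.mul_eq i)
  have e2 := congrArg (fun T : H →L[ℂ] H => T ξ) (h.corner i)
  simp only [mul_apply_eq_comp, sub_apply, one_apply_eq_self, map_sub, zero_apply] at e e2 ⊢
  have e3 : p i (creation p x ξ) = p i (x i ξ) - p i (x i (p i ξ)) := by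
    simpa using e
  rw [e3, ← sub_eq_zero, ← neg_eq_zero, ← e2]; abel

theorem creation_eq_sum (ξ : H) : creation p x ξ = ∑ i, p i (creation p x ξ) := by
  simp_rw [h.apply_creation]
  rw [creation, sum_apply]
  refine Finset.sum_congr rfl fun i _ => ?_
  have e2 := congrArg (fun T : H →L[ℂ] H => T ξ) (h.corner i)
  simp only [mul_apply_eq_comp, sub_apply, one_apply_eq_self, zero_apply] at e2 ⊢
  exact (sub_eq_zero.mp e2).symm

theorem norm_sq_sum (ξ : H) : ‖∑ i, p i ξ‖ ^ 2 = ∑ i, ‖p i ξ‖ ^ 2 := by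
  have : (‖∑ i, p i ξ‖ ^ 2 : ℂ) = ∑ i, (‖p i ξ‖ ^ 2 : ℂ) := by
    rw [← RCLike.ofReal_eq_complex_ofReal, ← inner_self_eq_norm_sq_to_K, sum_inner]
    refine Finset.sum_congr rfl fun i _ => ?_
    rw [inner_sum, Finset.sum_eq_single i]
    · rw [inner_self_eq_norm_sq_to_K]
    · intro j _ hj
      rw [h.inner_apply, h.apply_apply, if_neg (Ne.symm hj), inner_zero_right]
    · simp
  exact_mod_cast this

theorem sum_norm_sq_le (ξ : H) : ∑ i, ‖p i ξ‖ ^ 2 ≤ ‖ξ‖ ^ 2 := by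
  have o : ⟪∑ i, p i ξ, ξ - ∑ i, p i ξ⟫_ℂ = 0 := by
    rw [sum_inner]
    refine Finset.sum_eq_zero fun i _ => ?_
    rw [h.inner_apply, map_sub, map_sum]
    simp [h.apply_apply]
  have := norm_add_sq_eq_norm_sq_add_norm_sq_of_inner_eq_zero _ _ o
  rw [add_sub_cancel] at this
  rw [← h.norm_sq_sum]
  nlinarith [norm_nonneg (ξ - ∑ i, p i ξ)]

/-! ### The weighted quadratic form -/

theorem weightForm_le (ξ : H) : weightForm p t ξ ≤ ‖ξ‖ ^ 2 := by
  refine sub_le_self _ (Finset.sum_nonneg fun i _ => ?_)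
  have := h.nonneg i
  positivity

theorem le_weightForm (ξ : H) : (1 + ∑ i, t i)⁻¹ * ‖ξ‖ ^ 2 ≤ weightForm p t ξ := by
  have hs : 0 ≤ ∑ i, t i := Finset.sum_nonneg fun i _ => h.nonneg i
  have key : ∑ i, t i / (1 + t i) * ‖p i ξ‖ ^ 2 ≤ (1 - (1 + ∑ i, t i)⁻¹) * ‖ξ‖ ^ 2 := by
    calc ∑ i, t i / (1 + t i) * ‖p i ξ‖ ^ 2
        ≤ ∑ i, (1 - (1 + ∑ i, t i)⁻¹) * ‖p i ξ‖ ^ 2 := by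
          refine Finset.sum_le_sum fun i _ => mul_le_mul_of_nonneg_right ?_ (by positivity)
          have h0 := h.nonneg i
          have h1 : t i ≤ ∑ i, t i :=
            Finset.single_le_sum (f := t) (fun j _ => h.nonneg j) (Finset.mem_univ i)
          have h2 : t i / (1 + t i) = 1 - (1 + t i)⁻¹ := by field_simp; ring
          rw [h2]
          gcongr
      _ = (1 - (1 + ∑ i, t i)⁻¹) * ∑ i, ‖p i ξ‖ ^ 2 := by rw [Finset.mul_sum]
      _ ≤ _ := by
          refine mul_le_mul_of_nonneg_left (h.sum_norm_sq_le ξ) ?_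
          rw [sub_nonneg]
          exact inv_le_one_of_one_le₀ (by linarith)
  rw [weightForm]
  linarith

/-- The weights `w = t i / (1 + t i)` solve `(1 - w) * t i = w`, so the terms in `‖p i ξ‖ ^ 2` occur
with the same coefficients before and after applying `creation p x`. -/
theorem weightForm_creation (ξ : H) : weightForm p t (creation p x ξ) =
    weightForm p t ξ - (1 - ∑ i, t i / (1 + t i)) * ‖ξ‖ ^ 2 := by
  have e1 : ∀ i, ‖p i (creation p x ξ)‖ ^ 2 = t i * (‖ξ‖ ^ 2 - ‖p i ξ‖ ^ 2) := fun i => by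
    rw [h.apply_creation, h.norm_sq, h.norm_sq_one_sub]
  have e2 : ‖creation p x ξ‖ ^ 2 = ∑ i, ‖p i (creation p x ξ)‖ ^ 2 := by
    conv_lhs => rw [h.creation_eq_sum, h.norm_sq_sum]
  have e3 : ∑ i, ‖p i (creation p x ξ)‖ ^ 2 - ∑ i, t i / (1 + t i) * ‖p i (creation p x ξ)‖ ^ 2 =
      (∑ i, t i / (1 + t i)) * ‖ξ‖ ^ 2 - ∑ i, t i / (1 + t i) * ‖p i ξ‖ ^ 2 := by
    rw [Finset.sum_mul, ← Finset.sum_sub_distrib, ← Finset.sum_sub_distrib]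
    refine Finset.sum_congr rfl fun i _ => ?_
    have := h.nonneg i
    rw [e1]
    field_simp
    ring
  rw [weightForm, weightForm, e2, e3]
  ring

theorem weightForm_creation_pow_le (ξ : H) (k : ℕ) (hC : ∑ i, t i / (1 + t i) ≤ 1) :
    weightForm p t ((creation p x ^ k) ξ) ≤ (∑ i, t i / (1 + t i)) ^ k * weightForm p t ξ := by
  have hC0 : 0 ≤ ∑ i, t i / (1 + t i) := Finset.sum_nonneg fun i _ => by
    have := h.nonneg i
    positivity
  induction k with
  | zero => simp
  | succ k ih =>
    rw [pow_succ', mul_apply_eq_comp, h.weightForm_creation]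
    have := h.weightForm_le ((creation p x ^ k) ξ)
    have h2 := mul_le_mul_of_nonneg_left this (sub_nonneg.mpr hC)
    have h3 := mul_le_mul_of_nonneg_left ih hC0
    rw [pow_succ' _ k, mul_assoc]
    linarith

theorem isUnit_one_sub_creation (hC : ∑ i, t i / (1 + t i) < 1) :
    IsUnit (1 - creation p x) := by
  have hC0 : 0 ≤ ∑ i, t i / (1 + t i) := Finset.sum_nonneg fun i _ => by
    have := h.nonneg i
    positivity
  set C := ∑ i, t i / (1 + t i) with hCdef
  have hs : 0 ≤ ∑ i, t i := Finset.sum_nonneg fun i _ => h.nonneg i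
  have hs' : 0 < 4 * (1 + ∑ i, t i) := by positivity
  -- Comparing the form with the squared norm costs a factor `1 + ∑ i, t i`; the remaining `1 / 4`
  -- is the square of the bound `1 / 2`.
  obtain ⟨k, hk⟩ := exists_pow_lt_of_lt_one (inv_pos.mpr hs') hC
  have hnorm : ‖creation p x ^ k‖ ≤ 1 / 2 := by
    refine ContinuousLinearMap.opNorm_le_bound _ (by norm_num) fun ξ => ?_
    have h1 := h.le_weightForm ((creation p x ^ k) ξ)
    have h2 := h.weightForm_creation_pow_le ξ k hC.le
    have h3 : C ^ k * weightForm p t ξ ≤ (4 * (1 + ∑ i, t i))⁻¹ * ‖ξ‖ ^ 2 :=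
      mul_le_mul hk.le (h.weightForm_le ξ)
        ((by positivity : 0 ≤ (1 + ∑ i, t i)⁻¹ * ‖ξ‖ ^ 2).trans (h.le_weightForm ξ))
        (by positivity)
    have h4 : (1 + ∑ i, t i)⁻¹ * ‖(creation p x ^ k) ξ‖ ^ 2
        ≤ (1 + ∑ i, t i)⁻¹ * (1 / 2 * ‖ξ‖) ^ 2 := by
      refine (h1.trans (h2.trans h3)).trans (le_of_eq ?_)
      rw [mul_inv]; ring
    have h5 := le_of_mul_le_mul_left h4 (by positivity)
    exact le_of_sq_le_sq h5 (by positivity)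
  have hu : IsUnit (1 - creation p x ^ k) :=
    (Units.oneSub (creation p x ^ k) (by linarith)).isUnit
  -- `1 - L ^ k` is `1 - L` times a geometric sum commuting with it, so both factors are units.
  rw [← mul_neg_geom_sum] at hu
  refine ((Commute.isUnit_mul_iff ?_).mp hu).1
  exact Commute.sum_right _ _ _ fun j _ =>
    (Commute.one_left _).sub_left ((Commute.refl _).pow_right j)

/-! ### The critical case -/

theorem weightForm_add_creation {Ω : H} (hpΩ : ∀ i, p i Ω = 0) (ξ : H) :
    weightForm p t (Ω + creation p x ξ) = ‖Ω‖ ^ 2 + weightForm p t (creation p x ξ) := by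
  have o : ⟪Ω, creation p x ξ⟫_ℂ = 0 := by
    rw [h.creation_eq_sum, inner_sum]
    exact Finset.sum_eq_zero fun i _ => by rw [← h.inner_apply, hpΩ, inner_zero_left]
  have := norm_add_sq_eq_norm_sq_add_norm_sq_of_inner_eq_zero _ _ o
  simp only [weightForm, map_add, hpΩ, zero_add]
  nlinarith

/-- The witness is `∑ j < k, Lʲ Ω`, built by `ξ ↦ Ω + L ξ`, with `L` the creation part. Each step
adds `1` to the form, since `Ω` is orthogonal to the range of `L` and `L` preserves the form; the
defect is `-Lᵏ Ω`. -/
theorem exists_weightForm_eq {Ω : H} (hΩ : ‖Ω‖ = 1) (hpΩ : ∀ i, p i Ω = 0)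
    (hC : ∑ i, t i / (1 + t i) = 1) (k : ℕ) :
    ∃ ξ : H, weightForm p t ξ = k ∧ weightForm p t ((1 - creation p x) ξ - Ω) = 1 := by
  have hc : ∀ η, weightForm p t (creation p x η) = weightForm p t η := fun η => by
    rw [h.weightForm_creation, hC]; ring
  induction k with
  | zero => exact ⟨0, by simp [weightForm], by simp [weightForm, hpΩ, hΩ]⟩
  | succ k ih =>
    obtain ⟨ξ, h1, h2⟩ := ih
    refine ⟨Ω + creation p x ξ, ?_, ?_⟩
    · rw [h.weightForm_add_creation hpΩ, hc, h1, hΩ]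
      push_cast; ring
    · have : (1 - creation p x) (Ω + creation p x ξ) - Ω
          = creation p x ((1 - creation p x) ξ - Ω) := by
        simp only [sub_apply, one_apply_eq_self, map_sub, map_add]
        abel
      rw [this, hc, h2]

/-- The witnesses have squared norm at least `k` while their images under `1 - creation p x` stay
bounded; a bounded left inverse would bound the witnesses too. -/
theorem mul_one_sub_creation_ne_one {Ω : H} (hΩ : ‖Ω‖ = 1) (hpΩ : ∀ i, p i Ω = 0)
    (hC : ∑ i, t i / (1 + t i) = 1) (y : H →L[ℂ] H) : y * (1 - creation p x) ≠ 1 := by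
  intro hy
  have hs : 0 ≤ ∑ i, t i := Finset.sum_nonneg fun i _ => h.nonneg i
  set s := ∑ i, t i
  obtain ⟨k, hk⟩ := exists_nat_gt ((‖y‖ * (1 + √(1 + s))) ^ 2)
  obtain ⟨ξ, h1, h2⟩ := h.exists_weightForm_eq hΩ hpΩ hC k
  have h3 : ‖(1 - creation p x) ξ - Ω‖ ≤ √(1 + s) := by
    refine Real.le_sqrt_of_sq_le ?_
    have := h.le_weightForm ((1 - creation p x) ξ - Ω)
    rwa [h2, inv_mul_le_iff₀ (by positivity), mul_one] at this
  have h4 : ‖(1 - creation p x) ξ‖ ≤ 1 + √(1 + s) := by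
    have := norm_le_norm_add_norm_sub Ω ((1 - creation p x) ξ)
    rw [norm_sub_rev, hΩ] at this
    linarith
  have h5 : ξ = y ((1 - creation p x) ξ) := by
    rw [← mul_apply_eq_comp, hy, one_apply_eq_self]
  have h6 : ‖ξ‖ ≤ ‖y‖ * (1 + √(1 + s)) := by
    conv_lhs => rw [h5]
    exact (y.le_opNorm _).trans (by gcongr)
  have h7 := h.weightForm_le ξ
  rw [h1] at h7
  have h8 : ‖ξ‖ ^ 2 ≤ (‖y‖ * (1 + √(1 + s))) ^ 2 := by gcongr
  linarith

end IsCreationFamily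

variable [Fintype ι] {p x r : ι → (H →L[ℂ] H)} {t : ι → ℝ}

omit [DecidableEq ι] in
theorem star_creation (hp : ∀ i, IsSelfAdjoint (p i)) :
    star (creation p (fun i => star (x i))) = annihilation p x := by
  simp only [creation, annihilation, star_sum, star_mul, star_sub, star_one, star_star,
    (hp _).star_eq, mul_assoc]

theorem isUnit_one_sub_sum (h : IsCreationFamily p x t)
    (h' : IsCreationFamily p (fun i => star (x i)) t)
    (hr : ∀ i, r i * (1 + x i) = 1) (hr' : ∀ i, (1 + x i) * r i = 1)
    (hC : ∑ i, t i / (1 + t i) < 1) : IsUnit (1 - ∑ i, (1 - r i)) := by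
  rw [one_sub_sum_eq_factorization h.mul_eq h.corner hr hr']
  refine (IsUnit.mul ?_ (isUnit_blockDiagonal h.mul_eq h.corner hr hr')).mul
    (h.isUnit_one_sub_creation hC)
  have := (h'.isUnit_one_sub_creation hC).star
  rwa [star_sub, star_one, star_creation h.isSelfAdjoint] at this

theorem not_isUnit_one_sub_sum (h : IsCreationFamily p x t)
    (hr : ∀ i, r i * (1 + x i) = 1) (hr' : ∀ i, (1 + x i) * r i = 1)
    (hC : ∑ i, t i / (1 + t i) = 1) {Ω : H} (hΩ : ‖Ω‖ = 1) (hpΩ : ∀ i, p i Ω = 0) :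
    ¬ IsUnit (1 - ∑ i, (1 - r i)) := by
  rintro ⟨u, hu⟩
  rw [one_sub_sum_eq_factorization h.mul_eq h.corner hr hr'] at hu
  refine h.mul_one_sub_creation_ne_one hΩ hpΩ hC
    (↑u⁻¹ * ((1 - annihilation p x) * blockDiagonal p r)) ?_
  rw [mul_assoc, ← hu, Units.inv_mul]

end Hilbert

/-! ### Reduced words in the GNS space -/

section Words

open scoped InnerProductSpace

variable {A : Type*} [CStarAlgebra A] [PartialOrder A] {ι : Type*}

/-- The words in centered elements of the `B i` in which neighbouring indices differ. -/
def reducedWords (φ : A →ₚ[ℂ] ℂ) (B : ι → Subalgebra ℂ A) : Set (List (ι × A)) :=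
  {w | (∀ p ∈ w, p.2 ∈ B p.1 ∧ φ p.2 = 0) ∧ w.IsChain (fun p q => p.1 ≠ q.1)}

/-- The reduced words whose first letter has index `i`. -/
def wordsFrom (φ : A →ₚ[ℂ] ℂ) (B : ι → Subalgebra ℂ A) (i : ι) : Set (List (ι × A)) :=
  {w | w ∈ reducedWords φ B ∧ ∃ p ∈ w.head?, p.1 = i}

variable {φ : A →ₚ[ℂ] ℂ} {B : ι → Subalgebra ℂ A}

theorem cons_mem_wordsFrom {i : ι} {y : A} (hy : y ∈ B i) (hφy : φ y = 0) {w : List (ι × A)}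
    (hw : w ∈ reducedWords φ B) (hwi : w ∉ wordsFrom φ B i) :
    (i, y) :: w ∈ wordsFrom φ B i := by
  refine ⟨⟨fun p hp => ?_, ?_⟩, (i, y), rfl, rfl⟩
  · rcases List.mem_cons.mp hp with rfl | hp
    · exact ⟨hy, hφy⟩
    · exact hw.1 p hp
  · rw [List.isChain_cons]
    exact ⟨fun q hq hiq => hwi ⟨hw, q, hq, hiq.symm⟩, hw.2⟩

omit [PartialOrder A] in
theorem star_prod_eq (w : List (ι × A)) : star (w.map Prod.snd).prod =
    ((w.reverse.map fun p => (p.1, star p.2)).map Prod.snd).prod := by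
  induction w with
  | nil => simp
  | cons p w ih =>
    simp only [List.map_cons, List.prod_cons, star_mul, ih, List.reverse_cons, List.map_append,
      List.prod_append, List.map_nil, List.prod_nil, mul_one]

/-- The adjoint reverses `w`, so the two first letters meet; their indices differ, and the
concatenation is again a nonempty reduced word. -/
theorem apply_star_mul_eq_zero (hB : ∀ i, ∀ y ∈ B i, star y ∈ B i)
    (hstar : ∀ y, φ (star y) = star (φ y))
    (hfree : FreelyIndependent φ B) {i : ι} {w w' : List (ι × A)} (hw : w ∈ wordsFrom φ B i)
    (hw' : w' ∈ reducedWords φ B) (hwi : w' ∉ wordsFrom φ B i) :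
    φ (star (w.map Prod.snd).prod * (w'.map Prod.snd).prod) = 0 := by
  obtain ⟨⟨hw1, hw2⟩, p, hp, rfl⟩ := hw
  rw [star_prod_eq, ← List.prod_append, ← List.map_append]
  refine hfree _ ?_ ?_ ?_
  · intro h
    have : w = [] := by simpa using (List.append_eq_nil_iff.mp h).1
    simp [this] at hp
  · intro q hq
    rcases List.mem_append.mp hq with hq | hq
    · obtain ⟨q', hq', rfl⟩ := List.mem_map.mp hq
      have := hw1 q' (by simpa using hq')
      exact ⟨hB _ _ this.1, by rw [hstar, this.2, star_zero]⟩
    · exact hw'.1 q hq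
  · rw [List.isChain_append]
    refine ⟨?_, hw'.2, ?_⟩
    · rw [List.isChain_map, List.isChain_reverse]
      exact hw2.imp fun _ _ h => h.symm
    · intro q hq q' hq' h
      rw [List.getLast?_map, List.getLast?_reverse] at hq
      obtain ⟨q0, hq0, rfl⟩ := Option.mem_map.mp hq
      have : q0 = p := Option.mem_unique hq0 hp
      subst this
      exact hwi ⟨hw', q', hq', h.symm⟩

/-- A first letter from `B i` is absorbed into `y`. The resulting factor splits into its centered
part, which lengthens the remaining word, and a scalar. -/
theorem mul_mem_span_words (hφ1 : φ 1 = 1) {i : ι} {y : A} (hy : y ∈ B i) {u : A}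
    (hu : u ∈ Submodule.span ℂ ((fun w => (w.map Prod.snd).prod) '' reducedWords φ B)) :
    y * u ∈ Submodule.span ℂ ((fun w => (w.map Prod.snd).prod) '' reducedWords φ B) := by
  have hcent : ∀ x ∈ B i, ∀ w ∈ reducedWords φ B, w ∉ wordsFrom φ B i →
      x * (w.map Prod.snd).prod ∈
        Submodule.span ℂ ((fun w => (w.map Prod.snd).prod) '' reducedWords φ B) := by
    intro x hx w hw hwi
    have h0 : x - algebraMap ℂ A (φ x) ∈ B i := sub_mem hx ((B i).algebraMap_mem _)
    have h1 : φ (x - algebraMap ℂ A (φ x)) = 0 := by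
      rw [map_sub, Algebra.algebraMap_eq_smul_one, map_smul, hφ1]; simp
    have h2 := Submodule.subset_span (R := ℂ)
      (Set.mem_image_of_mem (fun w => (w.map Prod.snd).prod) (cons_mem_wordsFrom h0 h1 hw hwi).1)
    have h3 := Submodule.smul_mem _ (φ x) (Submodule.subset_span (R := ℂ)
      (Set.mem_image_of_mem (fun w => (w.map Prod.snd).prod) hw))
    convert add_mem h2 h3 using 1
    simp [sub_mul, Algebra.algebraMap_eq_smul_one]
  induction hu using Submodule.span_induction with
  | zero => simp
  | add u v _ _ hu hv => rw [mul_add]; exact add_mem hu hv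
  | smul c u _ hu => rw [mul_smul_comm]; exact Submodule.smul_mem _ _ hu
  | mem u hu =>
    obtain ⟨w, hw, rfl⟩ := hu
    by_cases hwi : w ∈ wordsFrom φ B i
    · obtain ⟨_, p, hp, rfl⟩ := hwi
      match w, hw, hp with
      | q :: w, hw, hp =>
        obtain rfl : q = p := by simpa using hp
        have hw' : w ∈ reducedWords φ B :=
          ⟨fun q' hq' => hw.1 q' (List.mem_cons_of_mem _ hq'), hw.2.tail⟩
        have hwi' : w ∉ wordsFrom φ B q.1 := fun h => by
          obtain ⟨_, q', hq', e⟩ := h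
          exact (List.isChain_cons.mp hw.2).1 q' hq' e.symm
        have := hcent (y * q.2) (mul_mem hy (hw.1 q (by simp)).1) w hw' hwi'
        simpa [mul_assoc] using this
    · exact hcent y hy w hw hwi

end Words

/-! ### Projections onto word spaces -/

section GNS

open scoped InnerProductSpace

variable {A : Type*} [CStarAlgebra A] [PartialOrder A] [StarOrderedRing A] {ι : Type*}

/-- The vector of the GNS space given by an element of the algebra. -/
noncomputable def gnsVector (φ : A →ₚ[ℂ] ℂ) (x : A) : φ.GNS := ((φ.toPreGNS x : φ.PreGNS) : φ.GNS)

/-- The closed span of the reduced words whose first letter has index `i`. -/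
noncomputable def wordSpace (φ : A →ₚ[ℂ] ℂ) (B : ι → Subalgebra ℂ A) (i : ι) : Submodule ℂ φ.GNS :=
  (Submodule.span ℂ
    ((fun w => gnsVector φ (w.map Prod.snd).prod) '' wordsFrom φ B i)).topologicalClosure

instance (φ : A →ₚ[ℂ] ℂ) (B : ι → Subalgebra ℂ A) (i : ι) : CompleteSpace (wordSpace φ B i) :=
  (Submodule.isClosed_topologicalClosure _).completeSpace_coe

/-- The orthogonal projection onto `wordSpace φ B i`. -/
noncomputable def wordProj (φ : A →ₚ[ℂ] ℂ) (B : ι → Subalgebra ℂ A) (i : ι) : φ.GNS →L[ℂ] φ.GNS :=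
  (wordSpace φ B i).starProjection

variable {φ : A →ₚ[ℂ] ℂ} {B : ι → Subalgebra ℂ A}

theorem inner_gnsVector (x y : A) : ⟪gnsVector φ x, gnsVector φ y⟫_ℂ = φ (star x * y) := by
  rw [gnsVector, gnsVector, UniformSpace.Completion.inner_coe, PositiveLinearMap.preGNS_inner_def]
  simp

theorem gnsStarAlgHom_gnsVector (x y : A) :
    φ.gnsStarAlgHom x (gnsVector φ y) = gnsVector φ (x * y) := by
  simp [gnsVector]

theorem gnsVector_eq (x : A) : gnsVector φ x = φ.gnsStarAlgHom x (gnsVector φ 1) := by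
  rw [gnsStarAlgHom_gnsVector, mul_one]

theorem continuous_gnsStarAlgHom : Continuous φ.gnsStarAlgHom := map_continuous _

theorem continuous_gnsVector : Continuous (gnsVector φ) := by
  have : gnsVector φ = fun x => φ.gnsStarAlgHom x (gnsVector φ 1) := funext gnsVector_eq
  rw [this]
  have := continuous_gnsStarAlgHom (φ := φ)
  fun_prop

theorem gnsStarAlgHom_injective (hφ : IsFaithfulTracialState φ) :
    Function.Injective φ.gnsStarAlgHom := by
  refine (injective_iff_map_eq_zero _).mpr fun x hx => hφ.faithful x ?_
  rw [← inner_gnsVector, gnsVector_eq, hx]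
  simp

theorem denseRange_gnsVector : DenseRange (gnsVector φ) := by
  have h := UniformSpace.Completion.denseRange_coe (α := φ.PreGNS)
  rwa [DenseRange, ← φ.toPreGNS.surjective.range_comp] at h

theorem gnsVector_add (x y : A) : gnsVector φ (x + y) = gnsVector φ x + gnsVector φ y := by
  rw [gnsVector_eq, map_add, _root_.add_apply, ← gnsVector_eq, ← gnsVector_eq]

theorem gnsVector_smul (c : ℂ) (x : A) : gnsVector φ (c • x) = c • gnsVector φ x := by
  rw [gnsVector_eq, map_smul, _root_.smul_apply, ← gnsVector_eq]

/-- If the `B i` generate a dense subalgebra, then operators on the GNS space agree as soon as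
they agree on reduced words. -/
theorem clm_ext_words (hφ1 : φ 1 = 1) {G : Set A} (hG : ∀ y ∈ G, ∃ i, y ∈ B i)
    (hdense : Dense (Algebra.adjoin ℂ G : Set A)) {S T : φ.GNS →L[ℂ] φ.GNS}
    (h : ∀ w ∈ reducedWords φ B,
      S (gnsVector φ (w.map Prod.snd).prod) = T (gnsVector φ (w.map Prod.snd).prod)) : S = T := by
  set W := Submodule.span ℂ ((fun w : List (ι × A) => (w.map Prod.snd).prod) '' reducedWords φ B)
    with hW
  have h1 : ∀ u ∈ W, S (gnsVector φ u) = T (gnsVector φ u) := by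
    intro u hu
    induction hu using Submodule.span_induction with
    | zero => simp [gnsVector_eq (0 : A)]
    | add u v _ _ hu hv => rw [gnsVector_add, map_add, map_add, hu, hv]
    | smul c u _ hu => rw [gnsVector_smul, map_smul, map_smul, hu]
    | mem u hu =>
      obtain ⟨w, hw, rfl⟩ := hu
      exact h w hw
  have h2 : ∀ y ∈ Algebra.adjoin ℂ G, ∀ u ∈ W, y * u ∈ W := by
    intro y hy
    induction hy using Algebra.adjoin_induction with
    | mem y hy =>
      obtain ⟨i, hi⟩ := hG y hy
      exact fun u hu => mul_mem_span_words hφ1 hi hu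
    | algebraMap c =>
      intro u hu
      rw [← Algebra.smul_def]
      exact Submodule.smul_mem _ _ hu
    | add x y _ _ hx hy => intro u hu; rw [add_mul]; exact add_mem (hx u hu) (hy u hu)
    | mul x y _ _ hx hy => intro u hu; rw [mul_assoc]; exact hx _ (hy u hu)
  have h3 : (1 : A) ∈ W :=
    Submodule.subset_span ⟨[], ⟨by simp, List.isChain_nil⟩, by simp⟩
  have h4 : Dense (gnsVector φ '' (Algebra.adjoin ℂ G : Set A)) :=
    denseRange_gnsVector.dense_image continuous_gnsVector hdense
  refine ContinuousLinearMap.coeFn_injective (Continuous.ext_on h4 S.continuous T.continuous ?_)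
  rintro _ ⟨y, hy, rfl⟩
  exact h1 y (by simpa using h2 y hy 1 h3)

theorem gnsVector_mem_wordSpace {i : ι} {w : List (ι × A)} (hw : w ∈ wordsFrom φ B i) :
    gnsVector φ (w.map Prod.snd).prod ∈ wordSpace φ B i :=
  Submodule.le_topologicalClosure _ (Submodule.subset_span ⟨w, hw, rfl⟩)

theorem wordProj_of_mem {i : ι} {w : List (ι × A)} (hw : w ∈ wordsFrom φ B i) :
    wordProj φ B i (gnsVector φ (w.map Prod.snd).prod) = gnsVector φ (w.map Prod.snd).prod :=
  Submodule.starProjection_eq_self_iff.mpr (gnsVector_mem_wordSpace hw)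

variable (hφ : IsFaithfulTracialState φ) (hB : ∀ i, ∀ y ∈ B i, star y ∈ B i)
  (hfree : FreelyIndependent φ B)
include hB hfree

theorem wordProj_of_notMem {i : ι} {w : List (ι × A)} (hw : w ∈ reducedWords φ B)
    (hwi : w ∉ wordsFrom φ B i) : wordProj φ B i (gnsVector φ (w.map Prod.snd).prod) = 0 := by
  rw [wordProj, Submodule.starProjection_apply_eq_zero_iff, wordSpace, Submodule.orthogonal_closure,
    Submodule.mem_orthogonal]
  intro u hu
  induction hu using Submodule.span_induction with
  | zero => simp
  | add u v _ _ hu hv => rw [inner_add_left, hu, hv, add_zero]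
  | smul c u _ hu => rw [inner_smul_left, hu, mul_zero]
  | mem u hu =>
    obtain ⟨w', hw', rfl⟩ := hu
    rw [inner_gnsVector]
    exact apply_star_mul_eq_zero hB (fun y => map_star φ y) hfree hw' hw hwi

theorem wordProj_one (i : ι) : wordProj φ B i (gnsVector φ 1) = 0 := by
  have := wordProj_of_notMem hB hfree (i := i) (w := []) ⟨by simp, List.isChain_nil⟩
    (fun h => by simpa using h.2)
  simpa using this

theorem wordProj_mul [DecidableEq ι] (hφ1 : φ 1 = 1) {G : Set A} (hG : ∀ y ∈ G, ∃ i, y ∈ B i)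
    (hdense : Dense (Algebra.adjoin ℂ G : Set A)) (i j : ι) :
    wordProj φ B i * wordProj φ B j = if i = j then wordProj φ B i else 0 := by
  refine clm_ext_words hφ1 hG hdense fun w hw => ?_
  rw [mul_apply_eq_comp]
  by_cases hj : w ∈ wordsFrom φ B j
  · rw [wordProj_of_mem hj]
    split_ifs with hij
    · rfl
    · rw [wordProj_of_notMem hB hfree hw, _root_.zero_apply]
      rintro ⟨_, q, hq, rfl⟩
      obtain ⟨_, q', hq', rfl⟩ := hj
      exact hij (by rw [Option.mem_unique hq hq'])
  · rw [wordProj_of_notMem hB hfree hw hj, map_zero]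
    split_ifs with hij
    · rw [hij, wordProj_of_notMem hB hfree hw hj]
    · rfl

theorem corner_of_centered (hφ1 : φ 1 = 1) {G : Set A} (hG : ∀ y ∈ G, ∃ i, y ∈ B i)
    (hdense : Dense (Algebra.adjoin ℂ G : Set A)) {i : ι} {y : A} (hy : y ∈ B i) (hφy : φ y = 0) :
    (1 - wordProj φ B i) * φ.gnsStarAlgHom y * (1 - wordProj φ B i) = 0 := by
  refine clm_ext_words hφ1 hG hdense fun w hw => ?_
  simp only [mul_apply_eq_comp, _root_.sub_apply,
    one_apply_eq_self, _root_.zero_apply]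
  by_cases hi : w ∈ wordsFrom φ B i
  · simp [wordProj_of_mem hi]
  · have := cons_mem_wordsFrom hy hφy hw hi
    have h2 := wordProj_of_mem this
    rw [List.map_cons, List.prod_cons] at h2
    rw [wordProj_of_notMem hB hfree hw hi, sub_zero, gnsStarAlgHom_gnsVector, h2, sub_self]

/-- Resolvents lie only in the closure of `B i`; the identity for centered elements extends by
adding scalars and by continuity. -/
theorem corner_of_mem_closure (hφ1 : φ 1 = 1) {G : Set A} (hG : ∀ y ∈ G, ∃ i, y ∈ B i)
    (hdense : Dense (Algebra.adjoin ℂ G : Set A)) {i : ι} {y : A} (hy : y ∈ closure (B i : Set A)) :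
    (1 - wordProj φ B i) * φ.gnsStarAlgHom y * (1 - wordProj φ B i) =
      φ y • (1 - wordProj φ B i) := by
  have hc : IsClosed {y : A | (1 - wordProj φ B i) * φ.gnsStarAlgHom y * (1 - wordProj φ B i) =
      φ y • (1 - wordProj φ B i)} := by
    have h1 := continuous_gnsStarAlgHom (φ := φ)
    have h2 : Continuous φ := map_continuous φ
    exact isClosed_eq (by fun_prop) (by fun_prop)
  refine closure_minimal (fun y hy => ?_) hc hy
  have h0 : y - algebraMap ℂ A (φ y) ∈ B i := sub_mem hy ((B i).algebraMap_mem _)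
  have h1 : φ (y - algebraMap ℂ A (φ y)) = 0 := by
    rw [map_sub, Algebra.algebraMap_eq_smul_one, map_smul, hφ1]; simp
  have h2 := corner_of_centered hB hfree hφ1 hG hdense h0 h1
  have h3 : (1 - wordProj φ B i) * (1 - wordProj φ B i) = 1 - wordProj φ B i :=
    (Submodule.isIdempotentElem_starProjection (wordSpace φ B i)).one_sub
  rw [map_sub, mul_sub (1 - wordProj φ B i), sub_mul _ _ (1 - wordProj φ B i), sub_eq_zero, Algebra.algebraMap_eq_smul_one, map_smul, map_one,
    mul_smul_comm, smul_mul_assoc, mul_one, h3] at h2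
  exact h2

theorem isCreationFamily [DecidableEq ι] (hφ1 : φ 1 = 1) {G : Set A}
    (hG : ∀ y ∈ G, ∃ i, y ∈ B i) (hdense : Dense (Algebra.adjoin ℂ G : Set A)) {x : ι → A}
    (hx : ∀ i, x i ∈ closure (B i : Set A)) (hφx : ∀ i, φ (x i) = 0)
    (hxx : ∀ i, star (x i) * x i ∈ closure (B i : Set A)) :
    IsCreationFamily (wordProj φ B) (fun i => φ.gnsStarAlgHom (x i))
      (fun i => l2Norm φ (x i) ^ 2) where
  isSelfAdjoint i := isSelfAdjoint_starProjection _
  mul_eq := wordProj_mul hB hfree hφ1 hG hdense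
  corner i := by
    rw [corner_of_mem_closure hB hfree hφ1 hG hdense (hx i), hφx, zero_smul]
  nonneg i := sq_nonneg _
  norm_sq i ξ := by
    have hpos : 0 ≤ φ (star (x i) * x i) := map_nonneg φ (star_mul_self_nonneg _)
    have hpos' := RCLike.nonneg_iff.mp hpos
    have e : φ (star (x i) * x i) = ((l2Norm φ (x i) ^ 2 : ℝ) : ℂ) := by
      have : l2Norm φ (x i) ^ 2 = (φ (star (x i) * x i)).re := Real.sq_sqrt hpos'.1
      rw [this]
      exact Complex.ext rfl (by simpa using hpos'.2)
    -- The corner of `star (x i) * x i` is the scalar `φ (star (x i) * x i)`, which makes `x i` a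
    -- multiple of an isometry on the range of `1 - p i`.
    have h1 := corner_of_mem_closure hB hfree hφ1 hG hdense (hxx i)
    have hsa : IsSelfAdjoint (1 - wordProj φ B i) :=
      (IsSelfAdjoint.one _).sub (isSelfAdjoint_starProjection _)
    have h3 : (1 - wordProj φ B i) * (1 - wordProj φ B i) = 1 - wordProj φ B i :=
      (Submodule.isIdempotentElem_starProjection (wordSpace φ B i)).one_sub
    set Q := 1 - wordProj φ B i with hQ
    have h2 : (star (φ.gnsStarAlgHom (x i) * Q) * (φ.gnsStarAlgHom (x i) * Q)) ξ =
        (φ (star (x i) * x i) • (star Q * Q)) ξ := by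
      rw [hsa.star_eq, h3, ← h1, star_mul, hsa.star_eq, map_mul, map_star]
      simp only [mul_assoc]
    have h4 := congrArg (fun η => ⟪ξ, η⟫_ℂ) h2
    simp only [mul_apply_eq_comp, _root_.smul_apply,
      inner_smul_right, ContinuousLinearMap.star_eq_adjoint, ContinuousLinearMap.adjoint_inner_right,
      inner_self_eq_norm_sq_to_K, e, RCLike.ofReal_eq_complex_ofReal] at h4
    exact_mod_cast h4

end GNS

/-! ### Invertibility -/

section Main

variable {A : Type*} [CStarAlgebra A]

/-! ### Spectral permanence and passage to the generated subalgebra -/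

theorem inverse_mem_of_isClosed (S : StarSubalgebra ℂ A) (hS : IsClosed (S : Set A)) {u g : A}
    (hu : u ∈ S) (h1 : g * u = 1) (h2 : u * g = 1) : g ∈ S := by
  have : IsUnit (⟨u, hu⟩ : S) := by
    rw [← S.coe_isUnit]
    exact ⟨⟨u, g, h2, h1⟩, rfl⟩
  obtain ⟨v, hv⟩ := this
  have h3 : u * ((↑v⁻¹ : S) : A) = 1 := by
    have h4 : ((v : S) : A) * ((↑v⁻¹ : S) : A) = 1 := by
      rw [← MulMemClass.coe_mul, v.mul_inv, OneMemClass.coe_one]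
    rwa [hv] at h4
  rw [left_inv_eq_right_inv h1 h3]
  exact SetLike.coe_mem _

theorem isUnit_map_iff_of_injective {D E : Type*} [CStarAlgebra D] [CStarAlgebra E]
    (f : D →⋆ₐ[ℂ] E) (hf : Function.Injective f) (x : D) : IsUnit (f x) ↔ IsUnit x := by
  have hiso : Isometry f := NonUnitalStarAlgHom.isometry f hf
  have hcl : IsClosed (f.range : Set E) := by
    have : (f.range : Set E) = Set.range f := Set.ext fun _ => Iff.rfl
    rw [this]
    exact hiso.isClosedEmbedding.isClosed_range
  refine ⟨fun h => ?_, fun h => h.map f⟩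
  obtain ⟨u, hu⟩ := h
  have hmem : f x ∈ f.range := ⟨x, rfl⟩
  obtain ⟨y, hy⟩ : (↑u⁻¹ : E) ∈ f.range := inverse_mem_of_isClosed f.range hcl hmem
    (by rw [← hu, Units.inv_mul]) (by rw [← hu, Units.mul_inv])
  have hy' : f y = ↑u⁻¹ := hy
  refine ⟨⟨x, y, hf ?_, hf ?_⟩, rfl⟩
  · rw [map_mul, map_one, hy', ← hu, Units.mul_inv]
  · rw [map_mul, map_one, hy', ← hu, Units.inv_mul]

variable [PartialOrder A] {ι : Type*} [Fintype ι]

theorem l2Norm_star {φ : A →ₚ[ℂ] ℂ} (hφ : IsFaithfulTracialState φ) (x : A) :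
    l2Norm φ (star x) = l2Norm φ x := by
  rw [l2Norm, l2Norm, star_star, hφ.tracial]

theorem isUnit_of_dense [StarOrderedRing A] {φ : A →ₚ[ℂ] ℂ} (hφ : IsFaithfulTracialState φ)
    (a : ι → A) (hfree : StarFree φ a)
    (hdense : Dense (StarAlgebra.adjoin ℂ (Set.range a) : Set A)) {x r : ι → A}
    (hx : ∀ i, x i ∈ StarAlgebra.elemental ℂ (a i)) (hφx : ∀ i, φ (x i) = 0)
    (hr : ∀ i, r i * (1 + x i) = 1) (hr' : ∀ i, (1 + x i) * r i = 1) :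
    (∑ i, l2Norm φ (x i) ^ 2 / (1 + l2Norm φ (x i) ^ 2) < 1 → IsUnit (1 - ∑ i, (1 - r i))) ∧
    (∑ i, l2Norm φ (x i) ^ 2 / (1 + l2Norm φ (x i) ^ 2) = 1 → ¬ IsUnit (1 - ∑ i, (1 - r i))) := by
  classical
  let B : ι → Subalgebra ℂ A := fun i => (StarAlgebra.adjoin ℂ {a i}).toSubalgebra
  have hB : ∀ i, ∀ y ∈ B i, star y ∈ B i := fun i y hy =>
    star_mem (s := StarAlgebra.adjoin ℂ {a i}) hy
  have hcl : ∀ i y, y ∈ StarAlgebra.elemental ℂ (a i) → y ∈ closure (B i : Set A) :=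
    fun i y hy => hy
  have hG : ∀ y ∈ Set.range a ∪ star (Set.range a), ∃ i, y ∈ B i := by
    rintro y (⟨i, rfl⟩ | ⟨i, hi⟩)
    · exact ⟨i, StarAlgebra.self_mem_adjoin_singleton ℂ (a i)⟩
    · refine ⟨i, ?_⟩
      rw [← star_star y, ← hi]
      exact hB i _ (StarAlgebra.self_mem_adjoin_singleton ℂ (a i))
  have hd : Dense (Algebra.adjoin ℂ (Set.range a ∪ star (Set.range a)) : Set A) := hdense
  have hfam := isCreationFamily hB hfree hφ.map_one hG hd (fun i => hcl i _ (hx i)) hφx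
    (fun i => hcl i _ (mul_mem (star_mem (hx i)) (hx i)))
  have hfam' := isCreationFamily hB hfree hφ.map_one hG hd (x := fun i => star (x i))
    (fun i => hcl i _ (star_mem (hx i))) (fun i => by rw [map_star, hφx, star_zero])
    (fun i => hcl i _ (mul_mem (star_mem (star_mem (hx i))) (star_mem (hx i))))
  simp only [l2Norm_star hφ, map_star] at hfam'
  have hρ : ∀ i, φ.gnsStarAlgHom (r i) * (1 + φ.gnsStarAlgHom (x i)) = 1 := fun i => by
    simpa using congrArg φ.gnsStarAlgHom (hr i)
  have hρ' : ∀ i, (1 + φ.gnsStarAlgHom (x i)) * φ.gnsStarAlgHom (r i) = 1 := fun i => by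
    simpa using congrArg φ.gnsStarAlgHom (hr' i)
  have hT : φ.gnsStarAlgHom (1 - ∑ i, (1 - r i)) = 1 - ∑ i, (1 - φ.gnsStarAlgHom (r i)) := by
    simp only [map_sub, map_one, map_sum]
  rw [← isUnit_map_iff_of_injective _ (gnsStarAlgHom_injective hφ), hT]
  have hΩ : ‖gnsVector φ 1‖ = 1 := by
    have : (‖gnsVector φ 1‖ ^ 2 : ℂ) = 1 := by
      have h := inner_gnsVector (φ := φ) 1 1
      rw [inner_self_eq_norm_sq_to_K, star_one, one_mul, hφ.map_one] at h
      exact h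
    have h2 : ‖gnsVector φ 1‖ ^ 2 = 1 := by exact_mod_cast this
    exact (pow_eq_one_iff_of_nonneg (norm_nonneg _) two_ne_zero).mp h2
  exact ⟨fun hC => isUnit_one_sub_sum hfam hfam' hρ hρ' hC,
    fun hC => not_isUnit_one_sub_sum hfam hρ hρ' hC hΩ (wordProj_one hB hfree)⟩

/-- The restriction of a positive functional along a ⋆-homomorphism. -/
noncomputable def pullback [StarOrderedRing A] {D : Type*} [CStarAlgebra D] [PartialOrder D]
    [StarOrderedRing D] (φ : A →ₚ[ℂ] ℂ) (j : D →⋆ₐ[ℂ] A) : D →ₚ[ℂ] ℂ :=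
  PositiveLinearMap.mk₀ (φ.toLinearMap ∘ₗ j.toAlgHom.toLinearMap)
    fun _ hx => map_nonneg φ (map_nonneg j hx)

section Pullback

variable [StarOrderedRing A] {D : Type*} [CStarAlgebra D] [PartialOrder D] [StarOrderedRing D]
  {φ : A →ₚ[ℂ] ℂ} {j : D →⋆ₐ[ℂ] A}

theorem pullback_apply (x : D) : pullback φ j x = φ (j x) := rfl

theorem l2Norm_pullback (x : D) : l2Norm (pullback φ j) x = l2Norm φ (j x) := by
  rw [l2Norm, l2Norm, pullback_apply, map_mul, map_star]

theorem IsFaithfulTracialState.pullback (hφ : IsFaithfulTracialState φ)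
    (hj : Function.Injective j) : IsFaithfulTracialState (pullback φ j) where
  map_one := by rw [pullback_apply, _root_.map_one, hφ.map_one]
  faithful x hx := by
    rw [pullback_apply, map_mul, map_star] at hx
    exact hj (by rw [hφ.faithful _ hx, map_zero])
  tracial x y := by rw [pullback_apply, pullback_apply, map_mul j, map_mul j, hφ.tracial]

theorem StarFree.pullback {κ : Type*} {a : κ → D} (h : StarFree φ fun i => j (a i)) :
    StarFree (pullback φ j) a := by
  intro w hw h1 h2
  have := h (w.map fun p => (p.1, j p.2)) (by simpa using hw) ?_ ?_
  · rw [pullback_apply, map_list_prod]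
    simpa [Function.comp_def] using this
  · intro p hp
    obtain ⟨q, hq, rfl⟩ := List.mem_map.mp hp
    refine ⟨?_, (h1 q hq).2⟩
    have h3 : j q.2 ∈ (StarAlgebra.adjoin ℂ {a q.1}).map j := ⟨q.2, (h1 q hq).1, rfl⟩
    rwa [StarAlgHom.map_adjoin, Set.image_singleton] at h3
  · rw [List.isChain_map]
    exact h2

end Pullback

/-- Reduced words span a dense subspace only in the GNS space of the C⋆-algebra generated by the `a
i`. Restricting to it changes neither invertibility nor the norms. -/
theorem isUnit_of_starFree [StarOrderedRing A] {φ : A →ₚ[ℂ] ℂ} (hφ : IsFaithfulTracialState φ)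
    (a : ι → A) (hfree : StarFree φ a) (s : ι → ℂ) (g : ι → A)
    (hg : ∀ i, g i * (1 - s i • a i) = 1) (hg' : ∀ i, (1 - s i • a i) * g i = 1)
    (hf : ∀ i, φ (g i) ≠ 0) {C : ℝ}
    (hC : ∑ i, l2Norm φ ((φ (g i))⁻¹ • g i - 1) ^ 2 / (1 + l2Norm φ ((φ (g i))⁻¹ • g i - 1) ^ 2) = C) :
    (C < 1 → IsUnit (1 - ∑ i, (1 - φ (g i) • (1 - s i • a i)))) ∧
    (C = 1 → ¬ IsUnit (1 - ∑ i, (1 - φ (g i) • (1 - s i • a i)))) := by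
  let S := (StarAlgebra.adjoin ℂ (Set.range a)).topologicalClosure
  have hS : IsClosed (S : Set A) := StarSubalgebra.isClosed_topologicalClosure _
  let _ : PartialOrder S := CStarAlgebra.spectralOrder S
  have _ : StarOrderedRing S := CStarAlgebra.spectralOrderedRing S
  have haS : ∀ i, a i ∈ S := fun i =>
    StarSubalgebra.le_topologicalClosure _ (StarAlgebra.subset_adjoin ℂ _ ⟨i, rfl⟩)
  have hgS : ∀ i, g i ∈ S := fun i => inverse_mem_of_isClosed S hS
    (sub_mem (one_mem _) (SMulMemClass.smul_mem _ (haS i))) (hg i) (hg' i)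
  let b : ι → S := fun i => ⟨a i, haS i⟩
  let k : ι → S := fun i => ⟨g i, hgS i⟩
  have hk : ∀ i, k i * (1 - s i • b i) = 1 := fun i => Subtype.ext (hg i)
  have hk' : ∀ i, (1 - s i • b i) * k i = 1 := fun i => Subtype.ext (hg' i)
  have hinj : Function.Injective S.subtype := Subtype.val_injective
  have hdense : Dense (StarAlgebra.adjoin ℂ (Set.range b) : Set S) := by
    intro y
    rw [Topology.IsInducing.subtypeVal.closure_eq_preimage_closure_image]
    have himg : (Subtype.val '' (StarAlgebra.adjoin ℂ (Set.range b) : Set S) : Set A) =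
        (StarAlgebra.adjoin ℂ (Set.range a) : Set A) := by
      have h := StarAlgHom.map_adjoin S.subtype (Set.range b)
      rw [← Set.range_comp] at h
      exact congrArg (fun T : StarSubalgebra ℂ A => (T : Set A)) h
    have hy : (y : A) ∈ closure (Subtype.val '' (StarAlgebra.adjoin ℂ (Set.range b) : Set S)) := by
      rw [himg]
      exact y.2
    exact hy
  have hkel : ∀ i, k i ∈ StarAlgebra.elemental ℂ (b i) := fun i =>
    inverse_mem_of_isClosed _ (StarAlgebra.elemental.isClosed ℂ (b i))
      (sub_mem (one_mem _) (SMulMemClass.smul_mem _ (StarAlgebra.elemental.self_mem ℂ (b i))))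
      (hk i) (hk' i)
  have key := isUnit_of_dense (hφ.pullback hinj) b (StarFree.pullback (j := S.subtype) hfree) hdense
    (x := fun i => (φ (g i))⁻¹ • k i - 1) (r := fun i => φ (g i) • (1 - s i • b i))
    (fun i => sub_mem (SMulMemClass.smul_mem _ (hkel i)) (one_mem _))
    (fun i => by
      rw [pullback_apply]
      have : S.subtype ((φ (g i))⁻¹ • k i - 1) = (φ (g i))⁻¹ • g i - 1 := rfl
      rw [this, map_sub, map_smul, hφ.map_one, smul_eq_mul, inv_mul_cancel₀ (hf i), sub_self])
    (fun i => by
      rw [add_sub_cancel, smul_mul_smul_comm, hk', mul_inv_cancel₀ (hf i), one_smul])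
    (fun i => by
      rw [add_sub_cancel, smul_mul_smul_comm, hk, inv_mul_cancel₀ (hf i), one_smul])
  simp only [l2Norm_pullback] at key
  rw [← isUnit_map_iff_of_injective S.subtype hinj] at key
  have hT : S.subtype (1 - ∑ i, (1 - φ (g i) • (1 - s i • b i))) =
      1 - ∑ i, (1 - φ (g i) • (1 - s i • a i)) := by
    simp only [map_sub, map_one, map_sum, map_smul]
    rfl
  rw [hT] at key
  subst hC
  exact key

theorem sub_sum_eq_smul {n : ℕ} {φ : A →ₚ[ℂ] ℂ} {a : Fin n → A} {lam z : ℂ} {s : Fin n → ℂ}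
    (h : IsParam φ a lam z s) : algebraMap ℂ A lam - ∑ i, a i =
      z⁻¹ • (1 - ∑ i, (1 - mgf φ (a i) (s i) • (1 - s i • a i))) := by
  have h1 : ∀ i, z⁻¹ • (1 - mgf φ (a i) (s i) • (1 - s i • a i)) =
      algebraMap ℂ A (1 / z - 1 / s i) + a i := by
    intro i
    have hs : s i ≠ 0 := fun h0 => h.z_ne_zero (by rw [← h.mul_mgf i, h0, zero_mul])
    -- With this value, `z⁻¹ (1 - (z/s)(1 - s a)) = 1/z - 1/s + a`, whose scalar part is the
    -- negative of a summand of `lam`.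
    have hm : mgf φ (a i) (s i) = z / s i := by rw [← h.mul_mgf i, mul_div_cancel_left₀ _ hs]
    have hz := h.z_ne_zero
    have e1 : z⁻¹ * (z / s i) = 1 / s i := by field_simp
    have e2 : z⁻¹ * (z / s i) * s i = 1 := by field_simp
    rw [hm, smul_sub, smul_sub, smul_sub, smul_smul, smul_smul, smul_smul, e2, e1, one_smul,
      Algebra.algebraMap_eq_smul_one, sub_smul, one_div, one_div]
    abel
  rw [smul_sub, Finset.smul_sum]
  simp only [h1]
  rw [h.lam_eq, Finset.sum_add_distrib, ← map_sum, ← sub_sub, ← Algebra.algebraMap_eq_smul_one,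
    ← map_sub]
  congr 2
  simp only [Finset.sum_sub_distrib, one_div]
  ring

end Main

end FreeSpectra

open FreeSpectra in
theorem mainTheorem3 {A : Type*} [CStarAlgebra A] [PartialOrder A] [StarOrderedRing A]
    (φ : A →ₚ[ℂ] ℂ) (hφ : FreeSpectra.IsFaithfulTracialState φ)
    {n : ℕ} (a : Fin n → A) (hfree : FreeSpectra.StarFree φ a)
    (lam z : ℂ) (s : Fin n → ℂ) (hparam : FreeSpectra.IsParam φ a lam z s) :
    (FreeSpectra.criterion φ a s < 1 → lam ∉ spectrum ℂ (∑ i, a i)) ∧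
    (FreeSpectra.criterion φ a s = 1 →
      lam ∈ closure {mu : ℂ | ∃ (w : ℂ) (t : Fin n → ℂ),
        FreeSpectra.IsParam φ a mu w t ∧ FreeSpectra.criterion φ a t < 1} →
      lam ∈ spectrum ℂ (∑ i, a i)) := by
  have hf : ∀ i, mgf φ (a i) (s i) ≠ 0 := fun i h0 =>
    hparam.z_ne_zero (by rw [← hparam.mul_mgf i, h0, mul_zero])
  have key := isUnit_of_starFree hφ a hfree s (fun i => Ring.inverse (1 - s i • a i))
    (fun i => Ring.inverse_mul_cancel _ (hparam.isUnit i))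
    (fun i => Ring.mul_inverse_cancel _ (hparam.isUnit i)) hf (C := criterion φ a s) (by
      refine Finset.sum_congr rfl fun i _ => ?_
      have : (mgf φ (a i) (s i))⁻¹ • centeredResolvent φ (a i) (s i) =
          (φ (Ring.inverse (1 - s i • a i)))⁻¹ • Ring.inverse (1 - s i • a i) - 1 := by
        rw [centeredResolvent, smul_sub, Algebra.algebraMap_eq_smul_one, smul_smul,
          inv_mul_cancel₀ (hf i), one_smul, mgf]
      rw [this])
  have hspec : lam ∈ spectrum ℂ (∑ i, a i) ↔
      ¬ IsUnit (1 - ∑ i, (1 - mgf φ (a i) (s i) • (1 - s i • a i))) := by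
    rw [spectrum.mem_iff, sub_sum_eq_smul hparam]
    exact not_congr (isUnit_smul_iff (Units.mk0 z⁻¹ (inv_ne_zero hparam.z_ne_zero)) _)
  rw [hspec, not_not]
  exact ⟨key.1, fun hC _ => key.2 hC⟩
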